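/- Let $\Bbbk$ be a field, and let $\Delta$ be a simplicial complex on a finite vertex set $V$, that is, a family of subsets of $V$ (the faces of $\Delta$, the empty set being one of them) that is closed under taking subsets and contains $\{v\}$ for every $v\in V$. For $W\subseteq V$ let $\Delta[W]$ denote the complex of all faces of $\Delta$ contained in $W$. For an integer $q\geq 1$ let $$\sigma_q\Delta=\{F_1\cup\cdots\cup F_q : F_1,\ldots,F_q\in\Delta\}$$ be the $q$-secant complex of $\Delta$, again a simplicial complex on $V$, and call a simplicial complex $\Gamma$ on $V$ $(q+1)$-regular (over $\Bbbk$) if the reduced simplicial homology $\widetilde H_j(\Gamma[W],\Bbbk)$ vanishes for every nonempty $W\subseteq V$ and every integer $j\geq q$. If $\Delta$ is $2$-regular, then $\sigma_q\Delta$ is $(q+1)$-regular for every integer $q\geq 2$. -/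

import Mathlib

/-!
Simplicial complexes are Mathlib's `AbstractSimplicialComplex V`: a downward closed family of
nonempty finite subsets of `V` containing every singleton.  Mathlib does not list the empty face
among the faces; wherever the empty face matters it is added explicitly below.  Subcomplexes that do
not use all vertices are `PreAbstractSimplicialComplex V`.
-/

namespace SecantComplex

open Finset

variable {V : Type*}

/-- `F` is a face of `K` in the convention in which the empty set is also a face. -/
def IsFace (K : PreAbstractSimplicialComplex V) (F : Finset V) : Prop :=
  F = ∅ ∨ F ∈ K.faces

/-- The induced subcomplex `K[W]`, whose faces are the faces of `K` contained in `W`. -/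
def induced (K : PreAbstractSimplicialComplex V) (W : Finset V) :
    PreAbstractSimplicialComplex V where
  faces := {F | F ∈ K.faces ∧ F ⊆ W}
  isRelLowerSet_faces := fun {_} h =>
    ⟨(K.isRelLowerSet_faces h.1).1, fun _ hts ht =>
      ⟨(K.isRelLowerSet_faces h.1).2 hts ht, hts.trans h.2⟩⟩

section Secant

variable [DecidableEq V]

/-- The `q`-secant complex `σ_q Δ = {F₁ ∪ ⋯ ∪ F_q : F₁, …, F_q faces of Δ}`, for `q ≥ 1`, where the
`F_i` are allowed to be empty (and the empty union is left out of the list of faces). -/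
def secant (Δ : AbstractSimplicialComplex V) (q : ℕ) (hq : 1 ≤ q) :
    AbstractSimplicialComplex V where
  faces := {F | F.Nonempty ∧ ∃ f : Fin q → Finset V,
    (∀ i, IsFace Δ.toPreAbstractSimplicialComplex (f i)) ∧ F = univ.biUnion f}
  isRelLowerSet_faces := by
    rintro F ⟨hF, f, hf, rfl⟩
    refine ⟨hF, fun G hG hGne => ⟨hGne, fun i => f i ∩ G, fun i => ?_, ?_⟩⟩
    · rcases (f i ∩ G).eq_empty_or_nonempty with h | h
      · exact Or.inl h
      · rcases hf i with h' | h'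
        · simp [h'] at h
        · exact Or.inr ((Δ.isRelLowerSet_faces h').2 inter_subset_left h)
    · ext x
      have : x ∈ G → ∃ i, x ∈ f i := fun hx => by simpa using hG hx
      simp only [mem_biUnion, mem_univ, true_and, mem_inter]
      exact ⟨fun hx => (this hx).imp fun _ hi => ⟨hi, hx⟩, fun ⟨_, _, hx⟩ => hx⟩
  singleton_mem := fun v => by
    refine ⟨singleton_nonempty v, fun _ => {v}, fun _ => Or.inr (Δ.singleton_mem v), ?_⟩
    ext x
    simp only [mem_singleton, mem_biUnion, mem_univ, true_and]
    exact ⟨fun h => ⟨⟨0, hq⟩, h⟩, fun ⟨_, h⟩ => h⟩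

end Secant

section Homology

variable (𝕜 : Type*) [Field 𝕜] [LinearOrder V]

/-- The simplicial boundary map on formal linear combinations of finite subsets of a linearly
ordered vertex set: for `v₀ < ⋯ < v_j` it sends `{v₀, …, v_j}` to
`∑ i, (-1) ^ i • {v₀, …, v_j} \ {v_i}`.  In particular `{v}` is sent to `∅`, so that this is the
boundary map of the augmented (reduced) complex. -/
noncomputable def boundary : (Finset V →₀ 𝕜) →ₗ[𝕜] (Finset V →₀ 𝕜) :=
  Finsupp.linearCombination 𝕜 fun F : Finset V =>
    ∑ v ∈ F, Finsupp.single (F.erase v) ((-1 : 𝕜) ^ #{w ∈ F | w < v})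

/-- The reduced simplicial `j`-chains of `K`: linear combinations of the faces of dimension `j`,
i.e. with `j + 1` vertices.  The empty face spans the `(-1)`-chains. -/
def chains (K : PreAbstractSimplicialComplex V) (j : ℤ) : Submodule 𝕜 (Finset V →₀ 𝕜) :=
  Finsupp.supported 𝕜 𝕜 {F | IsFace K F ∧ (#F : ℤ) = j + 1}

/-- The reduced `j`-cycles of `K`. -/
noncomputable def cycles (K : PreAbstractSimplicialComplex V) (j : ℤ) :
    Submodule 𝕜 (Finset V →₀ 𝕜) :=
  chains 𝕜 K j ⊓ LinearMap.ker (boundary 𝕜)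

/-- The reduced `j`-boundaries of `K`. -/
noncomputable def boundaries (K : PreAbstractSimplicialComplex V) (j : ℤ) :
    Submodule 𝕜 (Finset V →₀ 𝕜) :=
  (chains 𝕜 K (j + 1)).map (boundary 𝕜)

lemma boundary_single (F : Finset V) (a : 𝕜) : boundary 𝕜 (Finsupp.single F a) =
    a • ∑ v ∈ F, Finsupp.single (F.erase v) ((-1 : 𝕜) ^ #{w ∈ F | w < v}) := by
  simp [boundary]

lemma boundary_boundary_single (F : Finset V) :
    boundary 𝕜 (boundary 𝕜 (Finsupp.single F 1)) = 0 := by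
  simp only [boundary_single, one_smul, map_sum, Finset.smul_sum, Finset.sum_sigma']
  have key : ∀ v ∈ F, ∀ w ∈ F, v < w →
      ((-1 : 𝕜) ^ #{u ∈ F | u < v} * (-1 : 𝕜) ^ #{u ∈ F.erase v | u < w}) +
      ((-1 : 𝕜) ^ #{u ∈ F | u < w} * (-1 : 𝕜) ^ #{u ∈ F.erase w | u < v}) = 0 := by
    intro v hv w hw hvw
    have h1 : {u ∈ F.erase w | u < v} = {u ∈ F | u < v} := by
      ext u; simp only [mem_filter, mem_erase]
      exact ⟨fun h => ⟨h.1.2, h.2⟩, fun h => ⟨⟨(h.2.trans hvw).ne, h.1⟩, h.2⟩⟩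
    have h2 : {u ∈ F.erase v | u < w} = {u ∈ F | u < w}.erase v := by
      ext u; simp only [mem_filter, mem_erase]; tauto
    have h3 : #({u ∈ F | u < w}.erase v) + 1 = #{u ∈ F | u < w} :=
      card_erase_add_one (by simp [hv, hvw])
    rw [h1, h2, ← h3, pow_succ]
    ring
  refine Finset.sum_involution (fun p _ => ⟨p.2, p.1⟩) ?_ ?_ ?_ ?_
  · rintro ⟨v, w⟩ h
    simp only [mem_sigma, mem_erase] at h
    simp only [Finsupp.smul_single, smul_eq_mul]
    rw [erase_right_comm (a := w) (b := v), ← Finsupp.single_add]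
    rcases lt_or_gt_of_ne h.2.1 with h' | h'
    · rw [add_comm, key w h.2.2 v h.1 h', Finsupp.single_zero]
    · rw [key v h.1 w h.2.2 h', Finsupp.single_zero]
  · rintro ⟨v, w⟩ h _ h'
    simp only [mem_sigma, mem_erase] at h
    exact h.2.1 (by simpa using congrArg Sigma.fst h')
  · rintro ⟨v, w⟩ h
    simp only [mem_sigma, mem_erase] at h ⊢
    exact ⟨h.2.2, Ne.symm h.2.1, h.1⟩
  · intros; rfl

/-- The boundary map squares to zero. -/
lemma boundary_boundary (x : Finset V →₀ 𝕜) : boundary 𝕜 (boundary 𝕜 x) = 0 := by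
  induction x using Finsupp.induction_linear with
  | zero => simp
  | add x y hx hy => simp [hx, hy]
  | single F a =>
    rw [← mul_one a, ← smul_eq_mul, ← Finsupp.smul_single, map_smul, map_smul,
      boundary_boundary_single, smul_zero]

lemma boundary_mem_chains (K : PreAbstractSimplicialComplex V) (j : ℤ) {x : Finset V →₀ 𝕜}
    (hx : x ∈ chains 𝕜 K (j + 1)) : boundary 𝕜 x ∈ chains 𝕜 K j := by
  rw [boundary, Finsupp.linearCombination_apply]
  refine Submodule.sum_mem _ fun F hF => Submodule.smul_mem _ _ (Submodule.sum_mem _ fun v hv => ?_)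
  obtain ⟨hK, hc⟩ := hx hF
  refine Finsupp.single_mem_supported 𝕜 _ ⟨?_, ?_⟩
  · rcases (F.erase v).eq_empty_or_nonempty with h | h
    · exact Or.inl h
    · rcases hK with hK | hK
      · simp [hK] at hv
      · exact Or.inr ((K.isRelLowerSet_faces hK).2 (erase_subset v F) h)
  · have := card_erase_add_one hv
    lia

/-- Boundaries are cycles. -/
lemma boundaries_le_cycles (K : PreAbstractSimplicialComplex V) (j : ℤ) :
    boundaries 𝕜 K j ≤ cycles 𝕜 K j := by
  rintro _ ⟨x, hx, rfl⟩
  exact ⟨boundary_mem_chains 𝕜 K j hx, boundary_boundary 𝕜 x⟩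

/-- The quotient `Z / (Z ∩ B)` of submodules of a module. -/
abbrev Subquotient {M : Type*} [AddCommGroup M] [Module 𝕜 M] (Z B : Submodule 𝕜 M) : Type _ :=
  Z ⧸ B.submoduleOf Z

/-- The reduced simplicial homology `H̃_j(K; 𝕜)`: cycles modulo boundaries. -/
abbrev ReducedHomology (K : PreAbstractSimplicialComplex V) (j : ℤ) : Type _ :=
  Subquotient 𝕜 (cycles 𝕜 K j) (boundaries 𝕜 K j)

lemma subsingleton_subquotient_iff {M : Type*} [AddCommGroup M] [Module 𝕜 M]
    (Z B : Submodule 𝕜 M) : Subsingleton (Subquotient 𝕜 Z B) ↔ Z ≤ B := by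
  rw [Submodule.Quotient.subsingleton_iff, Submodule.submoduleOf, Submodule.comap_subtype_eq_top]

/-- The reduced homology vanishes if and only if every cycle is a boundary. -/
lemma subsingleton_reducedHomology_iff (K : PreAbstractSimplicialComplex V) (j : ℤ) :
    Subsingleton (ReducedHomology 𝕜 K j) ↔ cycles 𝕜 K j ≤ boundaries 𝕜 K j :=
  subsingleton_subquotient_iff 𝕜 _ _

/-- `Δ` is `m`-regular over `𝕜`, for `m = q + 1` with `q ≥ 1`: the reduced homology
`H̃_j(Δ[W]; 𝕜)` vanishes for all nonempty sets `W` of vertices and all integers `j ≥ q = m - 1`. -/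
def IsRegular (Δ : AbstractSimplicialComplex V) (m : ℕ) : Prop :=
  ∀ W : Finset V, W.Nonempty → ∀ j : ℤ, (m : ℤ) ≤ j + 1 →
    Subsingleton (ReducedHomology 𝕜 (induced Δ.toPreAbstractSimplicialComplex W) j)

end Homology

end SecantComplex

/-! A `2`-regular complex is a flag complex (`IsRegular.isFace_of_pairwise`), and its graph
satisfies Dirac's theorem on chordal graphs: every nonempty `W` has a vertex `v` that spans, with
its neighbours in `W`, a face `Q` (`IsRegular.exists_isSimplicialVertex`). Dirac's key fact, that
minimal separators are cliques, comes from homology instead of chordless cycles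
(`IsRegular.isFace_of_joined`).

Now remove such a `v` from the `q`-secant complex on `W` (`IsRegular.isExactAt_unionsIn`). The
deletion is the `q`-secant complex on `W \ {v}`. If `Q` has another vertex `u`, then any face of `Δ`
in `W` through `v` stays a face when `u` is added, so the link is a cone. Otherwise `v` is isolated
and the link is the `(q - 1)`-secant complex on `W \ {v}`. Since the link enters one degree lower
(`isExactAt_of_link_of_deletion`), the drop in `q` is harmless and induction on `W` applies. -/

namespace SecantComplex

open Finset

/-! ### Cones, links and deletions in the augmented chain complex. -/

section Chains

variable {V : Type*} (𝕜 : Type*) [Field 𝕜]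

/-- Chains with `n` vertices supported on a family `S` of finite sets. -/
def familyChains (S : Set (Finset V)) (n : ℕ) : Submodule 𝕜 (Finset V →₀ 𝕜) :=
  Finsupp.supported 𝕜 𝕜 {F | F ∈ S ∧ #F = n}

variable {𝕜}

lemma mem_familyChains {S : Set (Finset V)} {n : ℕ} {x : Finset V →₀ 𝕜} :
    x ∈ familyChains 𝕜 S n ↔ ∀ F, x F ≠ 0 → F ∈ S ∧ #F = n := by
  simp [familyChains, Finsupp.mem_supported, Set.subset_def]

lemma familyChains_mono {S T : Set (Finset V)} (h : S ⊆ T) (n : ℕ) :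
    familyChains 𝕜 S n ≤ familyChains 𝕜 T n :=
  Finsupp.supported_mono fun _ hF => ⟨h hF.1, hF.2⟩

lemma single_mem_familyChains {S : Set (Finset V)} {F : Finset V} (hF : F ∈ S) (a : 𝕜) :
    Finsupp.single F a ∈ familyChains 𝕜 S #F :=
  Finsupp.single_mem_supported 𝕜 _ ⟨hF, rfl⟩

lemma linearCombination_mem {S : Set (Finset V)} {n : ℕ} {x : Finset V →₀ 𝕜}
    (hx : x ∈ familyChains 𝕜 S n) {f : Finset V → Finset V →₀ 𝕜}
    {M : Submodule 𝕜 (Finset V →₀ 𝕜)} (hf : ∀ F ∈ S, #F = n → f F ∈ M) :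
    Finsupp.linearCombination 𝕜 f x ∈ M := by
  rw [Finsupp.linearCombination_apply]
  refine Submodule.sum_mem _ fun F hF => Submodule.smul_mem _ _ ?_
  obtain ⟨h1, h2⟩ := hx hF
  exact hf F h1 h2

variable [LinearOrder V]

variable (𝕜) in
/-- Every cycle of the family `S` on faces with `n` vertices bounds in `S`. -/
def IsExactAt (S : Set (Finset V)) (n : ℕ) : Prop :=
  ∀ x ∈ familyChains 𝕜 S n, boundary 𝕜 x = 0 → ∃ y ∈ familyChains 𝕜 S (n + 1), boundary 𝕜 y = x

variable (𝕜) in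
/-- The cone operator with apex `v`, a contracting homotopy of the full simplex. -/
noncomputable def cone (v : V) : (Finset V →₀ 𝕜) →ₗ[𝕜] (Finset V →₀ 𝕜) :=
  Finsupp.linearCombination 𝕜 fun F : Finset V =>
    if v ∈ F then 0 else Finsupp.single (insert v F) ((-1 : 𝕜) ^ #{w ∈ F | w < v})

lemma boundary_mem_familyChains {S T : Set (Finset V)} {n : ℕ} {x : Finset V →₀ 𝕜}
    (hx : x ∈ familyChains 𝕜 S (n + 1)) (h : ∀ F ∈ S, ∀ v ∈ F, F.erase v ∈ T) :
    boundary 𝕜 x ∈ familyChains 𝕜 T n := by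
  refine linearCombination_mem hx fun F hF hc => Submodule.sum_mem _ fun v hv => ?_
  refine Finsupp.single_mem_supported 𝕜 _ ⟨h F hF v hv, ?_⟩
  have := card_erase_add_one hv
  lia

lemma cone_mem_familyChains {S T : Set (Finset V)} {n : ℕ} {x : Finset V →₀ 𝕜} {v : V}
    (hx : x ∈ familyChains 𝕜 S n) (h : ∀ F ∈ S, v ∉ F → insert v F ∈ T) :
    cone 𝕜 v x ∈ familyChains 𝕜 T (n + 1) := by
  refine linearCombination_mem hx fun F hF hc => ?_
  split_ifs with hv
  · exact zero_mem _
  · exact Finsupp.single_mem_supported 𝕜 _ ⟨h F hF hv, by rw [card_insert_of_notMem hv, hc]⟩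

lemma cone_single (v : V) (F : Finset V) (a : 𝕜) : cone 𝕜 v (Finsupp.single F a) =
    a • if v ∈ F then 0 else Finsupp.single (insert v F) ((-1 : 𝕜) ^ #{w ∈ F | w < v}) := by
  simp [cone]

lemma boundary_cone_add_cone_boundary_single (v : V) (F : Finset V) :
    boundary 𝕜 (cone 𝕜 v (Finsupp.single F 1)) + cone 𝕜 v (boundary 𝕜 (Finsupp.single F 1)) =
      Finsupp.single F 1 := by
  simp only [boundary_single, cone_single, one_smul, map_sum]
  by_cases hv : v ∈ F
  · rw [if_pos hv, map_zero, zero_add, ← add_sum_erase _ _ hv, sum_eq_zero, add_zero]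
    · have : {w ∈ F.erase v | w < v} = {w ∈ F | w < v} := by
        ext u; simp only [mem_filter, mem_erase]
        exact ⟨fun h => ⟨h.1.2, h.2⟩, fun h => ⟨⟨h.2.ne, h.1⟩, h.2⟩⟩
      simp [insert_erase hv, this, ← pow_add, ← two_mul]
    · intro w hw
      rw [mem_erase] at hw
      simp [hv, Ne.symm hw.1]
  · have e0 : {w ∈ insert v F | w < v} = {w ∈ F | w < v} := by
      ext u; simp only [mem_filter, mem_insert]
      exact ⟨fun h => ⟨h.1.resolve_left h.2.ne, h.2⟩, fun h => ⟨Or.inr h.1, h.2⟩⟩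
    rw [if_neg hv, boundary_single, sum_insert hv, erase_insert hv, e0, smul_add,
      Finsupp.smul_single, smul_eq_mul, ← pow_add, ← two_mul, pow_mul, neg_one_sq, one_pow,
      add_assoc, smul_sum, ← sum_add_distrib, sum_eq_zero, add_zero]
    intro w hw
    have hwv : w ≠ v := fun h => hv (h ▸ hw)
    have e1 : (insert v F).erase w = insert v (F.erase w) := erase_insert_of_ne hwv.symm
    rw [if_neg (by simp [hv]), e1, Finsupp.smul_single, Finsupp.smul_single, ← Finsupp.single_add,
      smul_eq_mul, smul_eq_mul]
    rcases lt_or_gt_of_ne hwv with h | h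
    · have e2 : {u ∈ insert v F | u < w} = {u ∈ F | u < w} := by
        ext u; simp only [mem_filter, mem_insert]
        exact ⟨fun k => ⟨k.1.resolve_left (k.2.trans h).ne, k.2⟩, fun k => ⟨Or.inr k.1, k.2⟩⟩
      have e3 : {u ∈ F.erase w | u < v} = {u ∈ F | u < v}.erase w := by
        ext u; simp only [mem_filter, mem_erase]; tauto
      have e4 : #({u ∈ F | u < v}.erase w) + 1 = #{u ∈ F | u < v} :=
        card_erase_add_one (by simp [hw, h])
      rw [e2, e3, ← e4, pow_succ, Finsupp.single_eq_zero]
      ring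
    · have e2 : {u ∈ insert v F | u < w} = insert v {u ∈ F | u < w} := by
        rw [filter_insert, if_pos h]
      have e3 : {u ∈ F.erase w | u < v} = {u ∈ F | u < v} := by
        ext u; simp only [mem_filter, mem_erase]
        exact ⟨fun k => ⟨k.1.2, k.2⟩, fun k => ⟨⟨(k.2.trans h).ne, k.1⟩, k.2⟩⟩
      rw [e2, e3, card_insert_of_notMem (by simp [hv]), pow_succ, Finsupp.single_eq_zero]
      ring

lemma boundary_cone_add_cone_boundary (v : V) (x : Finset V →₀ 𝕜) :
    boundary 𝕜 (cone 𝕜 v x) + cone 𝕜 v (boundary 𝕜 x) = x := by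
  induction x using Finsupp.induction_linear with
  | zero => simp
  | add x y hx hy =>
    simp only [map_add]
    nth_rewrite 3 [← hx]
    nth_rewrite 3 [← hy]
    abel
  | single F a =>
    rw [← mul_one a, ← smul_eq_mul, ← Finsupp.smul_single]
    simp only [map_smul]
    rw [← smul_add, boundary_cone_add_cone_boundary_single]

/-- The empty face being allowed, a family closed under insertion of `u` is acyclic. -/
lemma isExactAt_of_insert_mem {S : Set (Finset V)} {u : V} (h : ∀ F ∈ S, insert u F ∈ S) (n : ℕ) :
    IsExactAt 𝕜 S n := fun x hx hx0 =>
  ⟨cone 𝕜 u x, cone_mem_familyChains hx fun F hF _ => h F hF, by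
    simpa [hx0] using boundary_cone_add_cone_boundary u x⟩

/-- The link of the vertex `v` in the family `S`. -/
def link (S : Set (Finset V)) (v : V) : Set (Finset V) := {F | v ∉ F ∧ insert v F ∈ S}

/-- The deletion of the vertex `v` from the family `S`. -/
def deletion (S : Set (Finset V)) (v : V) : Set (Finset V) := {F | v ∉ F ∧ F ∈ S}

/-- The Mayer–Vietoris argument for the star and the deletion of `v`, which meet in the link,
carried out on chains. -/
lemma isExactAt_of_link_of_deletion {S : Set (Finset V)} (hS : IsLowerSet S) {v : V} {n : ℕ}
    (hl : IsExactAt 𝕜 (link S v) n) (hd : IsExactAt 𝕜 (deletion S v) (n + 1)) :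
    IsExactAt 𝕜 S (n + 1) := by
  intro x hx hx0
  have hx' := mem_familyChains.1 hx
  set x₀ := x.filter (v ∉ ·) with hx₀_def
  set x₁ := x.filter (¬ v ∉ ·) with hx₁_def
  have hsum : x₀ + x₁ = x := Finsupp.filter_add_filter_not x _
  have hx₀ : x₀ ∈ familyChains 𝕜 (deletion S v) (n + 1) := by
    rw [mem_familyChains]
    intro F hF
    rw [hx₀_def, Finsupp.filter_apply] at hF
    split_ifs at hF with hv
    · exact absurd rfl hF
    · exact ⟨⟨hv, (hx' F hF).1⟩, (hx' F hF).2⟩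
  have hx₁ : x₁ ∈ familyChains 𝕜 {F | v ∈ F ∧ F ∈ S} (n + 1) := by
    rw [mem_familyChains]
    intro F hF
    rw [hx₁_def, Finsupp.filter_apply] at hF
    split_ifs at hF with hv
    · exact absurd rfl hF
    · exact ⟨⟨not_not.1 hv, (hx' F hF).1⟩, (hx' F hF).2⟩
  have hz : boundary 𝕜 x₁ = -boundary 𝕜 x₀ := by
    rw [eq_neg_iff_add_eq_zero, add_comm, ← map_add, hsum, hx0]
  have hzl : boundary 𝕜 x₁ ∈ familyChains 𝕜 (link S v) n := by
    have h1 : boundary 𝕜 x₁ ∈ familyChains 𝕜 {F | insert v F ∈ S} n :=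
      boundary_mem_familyChains hx₁ fun F hF w _ =>
        hS (insert_subset hF.1 (erase_subset w F)) hF.2
    -- As `x` is a cycle, the boundary of `x₁` is minus that of `x₀`, which avoids `v`.
    have h2 : boundary 𝕜 x₁ ∈ familyChains 𝕜 {F | v ∉ F} n := by
      rw [hz]
      exact neg_mem (boundary_mem_familyChains hx₀ fun F hF w _ h => hF.1 (mem_of_mem_erase h))
    rw [mem_familyChains] at h1 h2 ⊢
    exact fun F hF => ⟨⟨(h2 F hF).1, (h1 F hF).1⟩, (h1 F hF).2⟩
  obtain ⟨y, hy, hyz⟩ := hl _ hzl (boundary_boundary 𝕜 x₁)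
  have hcone : cone 𝕜 v x₁ = 0 := by
    have := linearCombination_mem (M := ⊥) hx₁ (f := fun F : Finset V =>
      if v ∈ F then 0 else Finsupp.single (insert v F) ((-1 : 𝕜) ^ #{w ∈ F | w < v}))
      fun F hF _ => by simp [hF.1]
    exact (Submodule.mem_bot 𝕜).1 this
  -- All faces of `x₁` contain `v`, so `x₁` is the cone over its own boundary, which is also the
  -- boundary of `y`.
  have hx₁y : boundary 𝕜 (cone 𝕜 v y) + x₁ = y := by
    have h1 := boundary_cone_add_cone_boundary v x₁
    have h2 := boundary_cone_add_cone_boundary v y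
    rw [hcone, map_zero, zero_add] at h1
    rwa [hyz, h1] at h2
  have hld : link S v ⊆ deletion S v := fun F hF => ⟨hF.1, hS (subset_insert v F) hF.2⟩
  have hyd : y ∈ familyChains 𝕜 (deletion S v) (n + 1) :=
    familyChains_mono hld _ hy
  obtain ⟨w, hw, hwx⟩ := hd (x₀ + y) (add_mem hx₀ hyd) (by rw [map_add, hyz, hz, add_neg_cancel])
  refine ⟨w - cone 𝕜 v y, sub_mem (familyChains_mono (S := deletion S v) (fun F hF => hF.2) _ hw)
    (cone_mem_familyChains hy fun F hF _ => hF.2), ?_⟩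
  rw [map_sub, hwx, ← hsum]
  nth_rewrite 1 [← hx₁y]
  abel

end Chains

/-! ### Simplicial vertices in 2-regular complexes. -/

section Chordal

variable {V : Type*} {𝕜 : Type*} [Field 𝕜]

/-- The faces of `Δ` contained in `W`, including the empty one. -/
def facesIn (Δ : AbstractSimplicialComplex V) (W : Finset V) : Set (Finset V) :=
  {F | IsFace Δ.toPreAbstractSimplicialComplex F ∧ F ⊆ W}

lemma facesIn_mono {Δ : AbstractSimplicialComplex V} {W W' : Finset V} (h : W ⊆ W') :
    facesIn Δ W ⊆ facesIn Δ W' := fun _ hF => ⟨hF.1, hF.2.trans h⟩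

lemma IsFace.mono {K : PreAbstractSimplicialComplex V} {F G : Finset V} (hF : IsFace K F)
    (h : G ⊆ F) : IsFace K G := by
  rcases G.eq_empty_or_nonempty with hG | hG
  · exact Or.inl hG
  rcases hF with rfl | hF
  · exact Or.inl (subset_empty.1 h)
  · exact Or.inr ((K.isRelLowerSet_faces hF).2 h hG)

lemma isFace_singleton (Δ : AbstractSimplicialComplex V) (v : V) :
    IsFace Δ.toPreAbstractSimplicialComplex {v} := Or.inr (Δ.singleton_mem v)

lemma isFace_induced_iff {K : PreAbstractSimplicialComplex V} {W F : Finset V} :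
    IsFace (induced K W) F ↔ IsFace K F ∧ F ⊆ W := by
  constructor
  · rintro (rfl | h)
    · exact ⟨Or.inl rfl, empty_subset W⟩
    · exact ⟨Or.inr h.1, h.2⟩
  · rintro ⟨rfl | h, hW⟩
    · exact Or.inl rfl
    · exact Or.inr ⟨h, hW⟩

variable [LinearOrder V]

/-- Passes from integer degrees to numbers of vertices: degree `n - 1` means `n` vertices. -/
lemma subsingleton_reducedHomology_iff_isExactAt (K : PreAbstractSimplicialComplex V) (n : ℕ) :
    Subsingleton (ReducedHomology 𝕜 K ((n : ℤ) - 1)) ↔ IsExactAt 𝕜 {F | IsFace K F} n := by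
  have h : ∀ (m : ℕ) (j : ℤ), (m : ℤ) = j + 1 →
      chains 𝕜 K j = familyChains 𝕜 {F | IsFace K F} m := by
    intro m j hj
    unfold chains familyChains
    congr 1
    ext F
    simp [← hj]
  rw [subsingleton_reducedHomology_iff, cycles, boundaries, h n _ (by ring),
    h (n + 1) _ (by push_cast; ring)]
  exact ⟨fun H x hx hx0 => H ⟨hx, hx0⟩, fun H x hx => H x hx.1 hx.2⟩

lemma isRegular_iff_isExactAt (Δ : AbstractSimplicialComplex V) (m : ℕ) :
    IsRegular 𝕜 Δ m ↔ ∀ W : Finset V, W.Nonempty → ∀ n, m ≤ n → IsExactAt 𝕜 (facesIn Δ W) n := by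
  have h (W : Finset V) (n : ℕ) : Subsingleton (ReducedHomology 𝕜
      (induced Δ.toPreAbstractSimplicialComplex W) ((n : ℤ) - 1)) ↔
      IsExactAt 𝕜 (facesIn Δ W) n := by
    rw [subsingleton_reducedHomology_iff_isExactAt]
    simp only [isFace_induced_iff, facesIn]
  refine forall₂_congr fun W _ => ⟨fun H n hn => (h W n).1 (H _ (by lia)), fun H j hj => ?_⟩
  obtain ⟨n, hn⟩ := Int.eq_ofNat_of_zero_le (show 0 ≤ j + 1 by lia)
  obtain rfl : j = (n : ℤ) - 1 := by lia
  exact (h W n).2 (H n (by lia))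

/-- A `2`-regular complex is a flag complex. -/
lemma IsRegular.isFace_of_pairwise {Δ : AbstractSimplicialComplex V} (hΔ : IsRegular 𝕜 Δ 2)
    (F : Finset V) (hF : ∀ u ∈ F, ∀ v ∈ F, IsFace Δ.toPreAbstractSimplicialComplex {u, v}) :
    IsFace Δ.toPreAbstractSimplicialComplex F := by
  induction F using Finset.strongInduction with
  | H F ih =>
  by_contra hn
  have hsub : ∀ G, G ⊂ F → IsFace Δ.toPreAbstractSimplicialComplex G := fun G hG =>
    ih G hG fun u hu v hv => hF u (hG.1 hu) v (hG.1 hv)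
  have hne : F.Nonempty := nonempty_iff_ne_empty.2 fun h => hn (Or.inl h)
  obtain ⟨n, hcard⟩ : ∃ n, #F = n + 1 := ⟨#F - 1, by have := hne.card_pos; lia⟩
  have hn2 : 2 ≤ n := by
    by_contra hlt
    rcases (by lia : #F = 1 ∨ #F = 2) with h | h
    · obtain ⟨v, rfl⟩ := card_eq_one.1 h
      exact hn (isFace_singleton Δ v)
    · obtain ⟨u, v, -, rfl⟩ := card_eq_two.1 h
      exact hn (hF u (by simp) v (by simp))
  have hchain : boundary 𝕜 (Finsupp.single F 1) ∈ familyChains 𝕜 (facesIn Δ F) n :=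
    boundary_mem_familyChains (S := {F})
      (by rw [← hcard]; exact single_mem_familyChains (Set.mem_singleton F) 1) <| by
      rintro _ rfl v hv
      exact ⟨hsub _ (erase_ssubset hv), erase_subset _ _⟩
  obtain ⟨y, hy, hyF⟩ := (isRegular_iff_isExactAt Δ 2).1 hΔ F hne n hn2 _ hchain
    (boundary_boundary 𝕜 _)
  -- The only subset of `F` with `n + 1` elements is `F`, which is not a face.
  have hy0 : y = 0 := by
    ext G
    by_contra hG
    obtain ⟨⟨h1, h2⟩, h3⟩ := mem_familyChains.1 hy G hG
    exact hn (eq_of_subset_of_card_le h2 (by lia) ▸ h1)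
  rw [hy0, map_zero] at hyF
  obtain ⟨v, hv⟩ := hne
  have h1 := boundary_cone_add_cone_boundary v (Finsupp.single F (1 : 𝕜))
  rw [← hyF, cone_single, if_pos hv] at h1
  simp [eq_comm] at h1

/-- The vertices `x` and `y` are homologous in the faces of `Δ` contained in `U`. -/
def Joined (𝕜 : Type*) [Field 𝕜] (Δ : AbstractSimplicialComplex V) (U : Finset V) (x y : V) :
    Prop :=
  ∃ p ∈ familyChains 𝕜 (facesIn Δ U) 2,
    boundary 𝕜 p = Finsupp.single {y} 1 - Finsupp.single {x} 1

variable {Δ : AbstractSimplicialComplex V}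

lemma Joined.refl (U : Finset V) (x : V) : Joined 𝕜 Δ U x x :=
  ⟨0, zero_mem _, by simp⟩

lemma Joined.symm {U : Finset V} {x y : V} (h : Joined 𝕜 Δ U x y) : Joined 𝕜 Δ U y x := by
  obtain ⟨p, hp, hpb⟩ := h
  exact ⟨-p, neg_mem hp, by rw [map_neg, hpb, neg_sub]⟩

lemma Joined.trans {U : Finset V} {x y z : V} (h : Joined 𝕜 Δ U x y) (h' : Joined 𝕜 Δ U y z) :
    Joined 𝕜 Δ U x z := by
  obtain ⟨p, hp, hpb⟩ := h
  obtain ⟨p', hp', hpb'⟩ := h'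
  exact ⟨p + p', add_mem hp hp', by rw [map_add, hpb, hpb']; abel⟩

lemma Joined.mono {U U' : Finset V} {x y : V} (h : Joined 𝕜 Δ U x y) (hU : U ⊆ U') :
    Joined 𝕜 Δ U' x y := by
  obtain ⟨p, hp, hpb⟩ := h
  exact ⟨p, familyChains_mono (facesIn_mono hU) _ hp, hpb⟩

lemma Joined.of_isFace {U : Finset V} {x y : V} (hx : x ∈ U) (hy : y ∈ U)
    (h : IsFace Δ.toPreAbstractSimplicialComplex {x, y}) : Joined 𝕜 Δ U x y := by
  rcases eq_or_ne x y with rfl | hxy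
  · exact Joined.refl U x
  refine ⟨cone 𝕜 x (Finsupp.single {y} 1), ?_, ?_⟩
  · refine cone_mem_familyChains (S := {{y}})
      (single_mem_familyChains (F := {y}) (Set.mem_singleton _) 1) ?_
    rintro _ rfl -
    exact ⟨h, insert_subset hx (singleton_subset_iff.2 hy)⟩
  · rw [eq_sub_iff_add_eq]
    convert boundary_cone_add_cone_boundary (𝕜 := 𝕜) x (Finsupp.single {y} 1) using 2
    simp [boundary_single, cone_single, filter_singleton]

/-- In a `2`-regular complex, two vertices joined through two sets of vertices without edges between
them form an edge: otherwise, they would give rise to a nonzero class in degree one. -/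
lemma IsRegular.isFace_of_joined (hΔ : IsRegular 𝕜 Δ 2) {A B : Finset V} {x y : V}
    (hAB : ∀ a ∈ A, ∀ b ∈ B, ¬ IsFace Δ.toPreAbstractSimplicialComplex {a, b})
    (hA : Joined 𝕜 Δ (A ∪ {x, y}) x y) (hB : Joined 𝕜 Δ (B ∪ {x, y}) x y) :
    IsFace Δ.toPreAbstractSimplicialComplex {x, y} := by
  by_contra hxy
  have hne : x ≠ y := by
    rintro rfl
    exact hxy (by simpa using isFace_singleton Δ x)
  obtain ⟨p, hp, hpb⟩ := hA
  obtain ⟨p', hp', hpb'⟩ := hB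
  set W := (A ∪ {x, y}) ∪ (B ∪ {x, y}) with hW
  have hpp : p - p' ∈ familyChains 𝕜 (facesIn Δ W) 2 :=
    sub_mem (familyChains_mono (facesIn_mono subset_union_left) _ hp)
      (familyChains_mono (facesIn_mono subset_union_right) _ hp')
  obtain ⟨c, hc, hcb⟩ := (isRegular_iff_isExactAt Δ 2).1 hΔ W ⟨x, by simp [hW]⟩ 2 le_rfl _ hpp
    (by rw [map_sub, hpb, hpb', sub_self])
  have hc' := mem_familyChains.1 hc
  set c₁ := c.filter (· ⊆ A ∪ {x, y}) with hc₁_def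
  -- No face meets both `A` and `B`, so the faces left over lie in `B ∪ {x, y}`.
  set c₂ := c.filter (¬ · ⊆ A ∪ {x, y}) with hc₂_def
  have hsum : c₁ + c₂ = c := Finsupp.filter_add_filter_not c _
  have hc₁ : c₁ ∈ familyChains 𝕜 (facesIn Δ (A ∪ {x, y})) 3 := by
    rw [mem_familyChains]
    intro F hF
    rw [hc₁_def, Finsupp.filter_apply] at hF
    split_ifs at hF with hv
    · exact ⟨⟨(hc' F hF).1.1, hv⟩, (hc' F hF).2⟩
    · exact absurd rfl hF
  have hc₂ : c₂ ∈ familyChains 𝕜 (facesIn Δ (B ∪ {x, y})) 3 := by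
    rw [mem_familyChains]
    intro F hF
    rw [hc₂_def, Finsupp.filter_apply] at hF
    split_ifs at hF with hv
    · exact absurd rfl hF
    · obtain ⟨⟨h1, h2⟩, h3⟩ := hc' F hF
      refine ⟨⟨h1, fun u hu => ?_⟩, h3⟩
      obtain ⟨b, hb, hbA⟩ := not_subset.1 hv
      have hbB : b ∈ B := by
        have := h2 hb
        simp only [hW, mem_union] at this hbA
        tauto
      have huA : u ∉ A := fun huA => hAB u huA b hbB
        (h1.mono (insert_subset hu (singleton_subset_iff.2 hb)))
      have := h2 hu
      simp only [hW, mem_union] at this ⊢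
      tauto
  have hface {U : Finset V} : ∀ F ∈ facesIn Δ U, ∀ v ∈ F, F.erase v ∈ facesIn Δ U :=
    fun F hF v _ => ⟨hF.1.mono (erase_subset v F), (erase_subset v F).trans hF.2⟩
  have h₁ := sub_mem (boundary_mem_familyChains hc₁ hface) hp
  have h₂ := neg_mem (add_mem (boundary_mem_familyChains hc₂ hface) hp')
  have heq : boundary 𝕜 c₁ - p = -(boundary 𝕜 c₂ + p') := by
    rw [← hsum, map_add] at hcb
    rw [sub_eq_iff_eq_add, ← add_sub_cancel_right (boundary 𝕜 c₁) (boundary 𝕜 c₂), hcb]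
    abel
  -- By `heq` this chain lives on both sides, hence on the nonface `{x, y}`. So `p` is a boundary,
  -- although its own boundary is nonzero.
  have hzero : boundary 𝕜 c₁ - p = 0 := by
    ext F
    by_contra hF
    obtain ⟨⟨hf, hFA⟩, hcard⟩ := mem_familyChains.1 h₁ F hF
    rw [heq] at hF
    obtain ⟨⟨-, hFB⟩, -⟩ := mem_familyChains.1 h₂ F hF
    have hsub : F ⊆ {x, y} := by
      intro u hu
      have h1 := hFA hu
      have h2 := hFB hu
      rw [mem_union] at h1 h2
      by_contra hu'
      have huB := h2.resolve_right hu'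
      exact hAB u (h1.resolve_right hu') u huB (by simpa using isFace_singleton Δ u)
    exact hxy (eq_of_subset_of_card_le hsub (by rw [hcard, card_pair hne]) ▸ hf)
  have := boundary_boundary 𝕜 c₁
  rw [sub_eq_zero.1 hzero, hpb, sub_eq_zero] at this
  have h2 := Finsupp.single_left_injective (one_ne_zero (α := 𝕜)) this
  exact hne (singleton_injective h2).symm

/-- The vertex `v` of the induced complex on `W` lies in a single maximal face. -/
def IsSimplicialVertex (Δ : AbstractSimplicialComplex V) (W : Finset V) (v : V) : Prop :=
  v ∈ W ∧ ∃ Q ∈ facesIn Δ W, ∀ w ∈ W, IsFace Δ.toPreAbstractSimplicialComplex {v, w} → w ∈ Q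

/-- Dirac's argument: `C` is the component of `b` among the non-neighbours of `a`, and `S`, the
neighbours of `a` touching `C`, is a clique. Requiring `v` to be non-adjacent to `a` is what steers
the induction away from `S`. -/
lemma IsRegular.exists_isSimplicialVertex_not_adj (hΔ : IsRegular 𝕜 Δ 2) (W : Finset V) (a b : V)
    (ha : a ∈ W) (hb : b ∈ W) (hab : ¬ IsFace Δ.toPreAbstractSimplicialComplex {a, b}) :
    ∃ v, IsSimplicialVertex Δ W v ∧ ¬ IsFace Δ.toPreAbstractSimplicialComplex {a, v} := by
  classical
  induction W using Finset.strongInduction generalizing a b with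
  | H W ih =>
  let Adj (u v : V) : Prop := IsFace Δ.toPreAbstractSimplicialComplex {u, v}
  have adj_symm {u v : V} (h : Adj u v) : Adj v u := by
    simpa only [Adj, pair_comm] using h
  let R (u v : V) : Prop := v ∈ W ∧ ¬ Adj a v ∧ Adj u v
  let C : Finset V := {c ∈ W | Relation.ReflTransGen R b c}
  have hCmem {c : V} : c ∈ C ↔ c ∈ W ∧ Relation.ReflTransGen R b c := mem_filter
  have hbC : b ∈ C := hCmem.2 ⟨hb, .refl⟩
  have hCa {c : V} (hc : c ∈ C) : ¬ Adj a c := by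
    rcases (hCmem.1 hc).2.cases_tail with rfl | ⟨d, -, h⟩
    · exact hab
    · exact h.2.1
  have hCclosed {c w : V} (hc : c ∈ C) (hw : w ∈ W) (hcw : Adj c w) (haw : ¬ Adj a w) : w ∈ C :=
    hCmem.2 ⟨hw, (hCmem.1 hc).2.tail ⟨hw, haw, hcw⟩⟩
  have hCjoined {c : V} (hc : c ∈ C) : Joined 𝕜 Δ C b c := by
    have h := (hCmem.1 hc).2
    clear hc
    induction h with
    | refl => exact .refl _ _
    | tail hd h ih' =>
      rename_i d e
      have hdC : d ∈ C := by
        rcases hd.cases_tail with rfl | ⟨d', -, h'⟩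
        · exact hbC
        · exact hCmem.2 ⟨h'.1, hd⟩
      exact ih'.trans (.of_isFace hdC (hCclosed hdC h.1 h.2.2 h.2.1) h.2.2)
  let S : Finset V := {s ∈ W | Adj a s ∧ ∃ c ∈ C, Adj c s}
  have hSmem {s : V} : s ∈ S ↔ s ∈ W ∧ Adj a s ∧ ∃ c ∈ C, Adj c s := mem_filter
  have hSclique {x y : V} (hx : x ∈ S) (hy : y ∈ S) : Adj x y := by
    obtain ⟨-, hax, c, hc, hcx⟩ := hSmem.1 hx
    obtain ⟨-, hay, d, hd, hdy⟩ := hSmem.1 hy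
    refine hΔ.isFace_of_joined (A := {a}) (B := C) (fun a' ha' c hc => ?_) ?_ ?_
    · rw [mem_singleton.1 ha']
      exact hCa hc
    · exact (Joined.of_isFace (by simp) (by simp) hax).symm.trans
        (.of_isFace (by simp) (by simp) hay)
    · have hsub : C ⊆ C ∪ {x, y} := subset_union_left
      exact ((Joined.of_isFace (hsub hc) (by simp) hcx).symm.trans
        (((hCjoined hc).symm.trans (hCjoined hd)).mono hsub)).trans
        (.of_isFace (hsub hd) (by simp) hdy)
  have hsubW : C ∪ S ⊆ W := union_subset (filter_subset _ _) (filter_subset _ _)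
  have haC : a ∉ C ∪ S := by
    intro h
    rcases mem_union.1 h with h | h
    · exact hCa h (by simpa [Adj] using isFace_singleton Δ a)
    · obtain ⟨-, -, c, hc, hca⟩ := hSmem.1 h
      exact hCa hc (adj_symm hca)
  have hlt : C ∪ S ⊂ W := ssubset_iff_of_subset hsubW |>.2 ⟨a, ha, haC⟩
  have hnbr {c w : V} (hc : c ∈ C) (hw : w ∈ W) (hcw : Adj c w) : w ∈ C ∪ S := by
    by_cases haw : Adj a w
    · exact mem_union_right _ (hSmem.2 ⟨hw, haw, c, hc, hcw⟩)
    · exact mem_union_left _ (hCclosed hc hw hcw haw)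
  have hlift {c : V} (hc : c ∈ C) (h : IsSimplicialVertex Δ (C ∪ S) c) :
      ∃ v, IsSimplicialVertex Δ W v ∧ ¬ IsFace Δ.toPreAbstractSimplicialComplex {a, v} := by
    obtain ⟨-, Q, hQ, hQc⟩ := h
    exact ⟨c, ⟨hsubW (mem_union_left _ hc), Q, ⟨hQ.1, hQ.2.trans hsubW⟩,
      fun w hw hcw => hQc w (hnbr hc hw hcw) hcw⟩, hCa hc⟩
  -- With `t` in the role of `a`, induction gives a simplicial vertex outside `S`, hence in `C`,
  -- where no neighbours in `W` are lost.
  have hdom {t u : V} (ht : t ∈ C ∪ S) (hu : u ∈ C ∪ S) (htu : ¬ Adj t u)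
      (htS : ∀ s ∈ S, Adj t s) :
      ∃ v, IsSimplicialVertex Δ W v ∧ ¬ IsFace Δ.toPreAbstractSimplicialComplex {a, v} := by
    obtain ⟨v, hv, htv⟩ := ih _ hlt t u ht hu htu
    refine hlift ?_ hv
    exact (mem_union.1 hv.1).resolve_right fun h => htv (htS v h)
  by_cases h1 : ∃ s ∈ S, ∃ u ∈ C ∪ S, ¬ Adj s u
  · obtain ⟨s, hs, u, hu, hsu⟩ := h1
    exact hdom (mem_union_right _ hs) hu hsu fun s' hs' => hSclique hs hs'
  push Not at h1
  by_cases h2 : ∃ t ∈ C ∪ S, ∃ u ∈ C ∪ S, ¬ Adj t u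
  · obtain ⟨t, ht, u, hu, htu⟩ := h2
    exact hdom ht hu htu fun s hs => adj_symm (h1 s hs t ht)
  push Not at h2
  exact hlift hbC ⟨mem_union_left _ hbC, C ∪ S, ⟨hΔ.isFace_of_pairwise _ h2, subset_rfl⟩,
    fun w hw _ => hw⟩

lemma IsRegular.exists_isSimplicialVertex (hΔ : IsRegular 𝕜 Δ 2) {W : Finset V}
    (hW : W.Nonempty) : ∃ v, IsSimplicialVertex Δ W v := by
  by_cases h : ∃ a ∈ W, ∃ b ∈ W, ¬ IsFace Δ.toPreAbstractSimplicialComplex {a, b}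
  · obtain ⟨a, ha, b, hb, hab⟩ := h
    obtain ⟨v, hv, -⟩ := hΔ.exists_isSimplicialVertex_not_adj W a b ha hb hab
    exact ⟨v, hv⟩
  · push Not at h
    obtain ⟨v, hv⟩ := hW
    exact ⟨v, hv, W, ⟨hΔ.isFace_of_pairwise W h, subset_rfl⟩, fun w hw _ => hw⟩

end Chordal

/-! ### Links and deletions in secant complexes. -/

section Secant

variable {V : Type*} {𝕜 : Type*} [Field 𝕜] [LinearOrder V] {Δ : AbstractSimplicialComplex V}

/-- The subsets of `W` that are unions of `q` faces of `Δ`. -/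
def unionsIn (Δ : AbstractSimplicialComplex V) (q : ℕ) (W : Finset V) : Set (Finset V) :=
  {F | (∃ f : Fin q → Finset V, (∀ i, IsFace Δ.toPreAbstractSimplicialComplex (f i)) ∧
    F = univ.biUnion f) ∧ F ⊆ W}

lemma isLowerSet_unionsIn (q : ℕ) (W : Finset V) : IsLowerSet (unionsIn Δ q W) := by
  rintro _ G hG ⟨⟨f, hf, rfl⟩, hW⟩
  have hG : G ⊆ univ.biUnion f := hG
  refine ⟨⟨fun i => f i ∩ G, fun i => (hf i).mono inter_subset_left, ?_⟩, hG.trans hW⟩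
  rw [← biUnion_inter, inter_eq_right.2 hG]

lemma facesIn_secant (q : ℕ) (hq : 1 ≤ q) (W : Finset V) :
    facesIn (secant Δ q hq) W = unionsIn Δ q W := by
  ext F
  refine and_congr_left fun _ => ⟨?_, fun h => ?_⟩
  · rintro (rfl | h)
    · exact ⟨fun _ => ∅, fun _ => Or.inl rfl, by ext; simp⟩
    · exact h.2
  · rcases F.eq_empty_or_nonempty with hF | hF
    · exact Or.inl hF
    · exact Or.inr ⟨hF, h⟩

lemma deletion_unionsIn (q : ℕ) (W : Finset V) (v : V) :
    deletion (unionsIn Δ q W) v = unionsIn Δ q (W.erase v) := by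
  ext F
  simp only [deletion, unionsIn, Set.mem_ofPred_eq, subset_erase]
  tauto

lemma isExactAt_unionsIn_of_forall_eq_empty {q n : ℕ} {W : Finset V} (hn : n ≠ 0)
    (h : ∀ F ∈ unionsIn Δ q W, F = ∅) : IsExactAt 𝕜 (unionsIn Δ q W) n := by
  intro x hx _
  refine ⟨0, zero_mem _, ?_⟩
  rw [map_zero]
  ext F
  by_contra hF
  obtain ⟨h1, h2⟩ := mem_familyChains.1 hx F (Ne.symm hF)
  exact hn (by rw [← h2, h F h1, card_empty])

/-- Whichever `f i` covers `v` lies in `Q`, so it can absorb `u`: the link is a cone with apex `u`.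
-/
lemma insert_mem_link_unionsIn {q : ℕ} {W Q : Finset V} {u v : V}
    (hQ : Q ∈ facesIn Δ W) (hvQ : ∀ w ∈ W, IsFace Δ.toPreAbstractSimplicialComplex {v, w} → w ∈ Q)
    (hu : u ∈ Q) (huv : u ≠ v) {F : Finset V} (hF : F ∈ link (unionsIn Δ q W) v) :
    insert u F ∈ link (unionsIn Δ q W) v := by
  obtain ⟨hv, ⟨f, hf, hFf⟩, hW⟩ := hF
  refine ⟨by simp [huv.symm, hv], ⟨?_, ?_⟩⟩
  · obtain ⟨i, -, hi⟩ := mem_biUnion.1 (hFf ▸ mem_insert_self v F)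
    have hfQ : f i ⊆ Q := fun w hw => hvQ w
      (hW (hFf ▸ mem_biUnion.2 ⟨i, mem_univ i, hw⟩))
      ((hf i).mono (insert_subset hi (singleton_subset_iff.2 hw)))
    refine ⟨Function.update f i (insert u (f i)), fun j => ?_, ?_⟩
    · rcases eq_or_ne j i with rfl | hj
      · rw [Function.update_self]
        exact hQ.1.mono (insert_subset hu hfQ)
      · rw [Function.update_of_ne hj]
        exact hf j
    · rw [insert_comm, hFf]
      ext w
      simp only [mem_insert, mem_biUnion, mem_univ, true_and]
      constructor
      · rintro (rfl | ⟨j, hj⟩)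
        · exact ⟨i, by simp⟩
        · refine ⟨j, ?_⟩
          rcases eq_or_ne j i with rfl | hji
          · simp [hj]
          · rwa [Function.update_of_ne hji]
      · rintro ⟨j, hj⟩
        rcases eq_or_ne j i with rfl | hji
        · rw [Function.update_self, mem_insert] at hj
          exact hj.imp_right fun h => ⟨j, h⟩
        · rw [Function.update_of_ne hji] at hj
          exact Or.inr ⟨j, hj⟩
  · rw [insert_comm]
    exact insert_subset (hQ.2 hu) hW

/-- Covering an isolated `v` uses up one of the `q + 1` faces, which must be `{v}`. -/
lemma link_unionsIn_of_isolated {q : ℕ} {W : Finset V} {v : V} (hv : v ∈ W)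
    (hiso : ∀ w ∈ W, IsFace Δ.toPreAbstractSimplicialComplex {v, w} → w = v) :
    link (unionsIn Δ (q + 1) W) v = unionsIn Δ q (W.erase v) := by
  ext F
  constructor
  · rintro ⟨hvF, ⟨f, hf, hFf⟩, hW⟩
    obtain ⟨i, -, hi⟩ := mem_biUnion.1 (hFf ▸ mem_insert_self v F)
    have hfv {w : V} (hw : w ∈ f i) : w = v := hiso w
      (hW (hFf ▸ mem_biUnion.2 ⟨i, mem_univ i, hw⟩))
      ((hf i).mono (insert_subset hi (singleton_subset_iff.2 hw)))
    refine ⟨⟨fun j => (f (i.succAbove j)).erase v, fun j => (hf _).mono (erase_subset _ _), ?_⟩,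
      subset_erase.2 ⟨(subset_insert v F).trans hW, hvF⟩⟩
    rw [← erase_insert hvF, hFf]
    ext w
    simp only [mem_erase, mem_biUnion, mem_univ, true_and]
    constructor
    · rintro ⟨hwv, j, hj⟩
      rcases eq_or_ne j i with rfl | hji
      · exact absurd (hfv hj) hwv
      · obtain ⟨k, rfl⟩ := Fin.exists_succAbove_eq hji
        exact ⟨k, hwv, hj⟩
    · rintro ⟨k, hwv, hk⟩
      exact ⟨hwv, _, hk⟩
  · rintro ⟨⟨f, hf, rfl⟩, hW⟩
    rw [subset_erase] at hW
    refine ⟨hW.2, ⟨Fin.cons {v} f, fun i => ?_, ?_⟩, insert_subset hv hW.1⟩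
    · refine Fin.cases ?_ (fun i => ?_) i
      · exact isFace_singleton Δ v
      · exact hf i
    · ext w
      simp [Fin.exists_fin_succ]

lemma IsRegular.isExactAt_unionsIn (hΔ : IsRegular 𝕜 Δ 2) (q n : ℕ) (W : Finset V)
    (hn : q + 1 ≤ n) : IsExactAt 𝕜 (unionsIn Δ q W) n := by
  induction W using Finset.strongInduction generalizing q n with
  | H W ih =>
  rcases W.eq_empty_or_nonempty with rfl | hW
  · exact isExactAt_unionsIn_of_forall_eq_empty (by lia) fun F hF => subset_empty.1 hF.2
  -- The isolated case lowers `q`, so the induction goes down to `q = 0`, where only the empty face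
  -- remains.
  rcases q with _ | q
  · refine isExactAt_unionsIn_of_forall_eq_empty (by lia) ?_
    rintro _ ⟨⟨f, -, rfl⟩, -⟩
    simp
  obtain ⟨n, rfl⟩ : ∃ m, n = m + 1 := ⟨n - 1, by lia⟩
  obtain ⟨v, hv, Q, hQ, hvQ⟩ := hΔ.exists_isSimplicialVertex hW
  have hlt := erase_ssubset hv
  refine isExactAt_of_link_of_deletion (isLowerSet_unionsIn _ _) (v := v) ?_ ?_
  · by_cases hu : ∃ u ∈ Q, u ≠ v
    · obtain ⟨u, hu, huv⟩ := hu
      exact isExactAt_of_insert_mem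
        (fun F hF => insert_mem_link_unionsIn hQ hvQ hu huv hF) n
    · push Not at hu
      rw [link_unionsIn_of_isolated hv fun w hw h => hu w (hvQ w hw h)]
      exact ih _ hlt q n (by lia)
  · rw [deletion_unionsIn]
    exact ih _ hlt (q + 1) (n + 1) hn

end Secant

end SecantComplex

theorem theorem3p3 {𝕜 : Type*} [Field 𝕜] {V : Type*} [Finite V] [LinearOrder V]
    (Δ : AbstractSimplicialComplex V) (hΔ : SecantComplex.IsRegular 𝕜 Δ 2)
    (q : ℕ) (hq : 2 ≤ q) :
    SecantComplex.IsRegular 𝕜 (SecantComplex.secant Δ q (one_le_two.trans hq)) (q + 1) := by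
  rw [SecantComplex.isRegular_iff_isExactAt]
  intro W _ n hn
  rw [SecantComplex.facesIn_secant]
  exact hΔ.isExactAt_unionsIn q n W hn
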